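/- Let $n\ge 0$ and let $w$ be a permutation of $[n]=\{1,\dots,n\}$. A state of the box-ball system is an injective map from the balls $1,\dots,n$ to boxes labelled by the natural numbers. A move of the system takes the balls in the order $1,2,\dots,n$ and moves each of them once, to the nearest empty box to its right. Start with the state in which the one-line notation $w_1\cdots w_n$ occupies $n$ consecutive boxes. Every state decomposes into maximal increasing strings of balls in consecutive boxes; a state is called steady if this decomposition is preserved by all subsequent moves. Then a steady state is reached from $w$ after finitely many moves. The soliton decomposition $\mathrm{SD}(w)$ is the array whose rows are, from top to bottom, the strings of a steady state, taken from right to left (it does not depend on which steady state is chosen). Let $\mathrm{P}(w)$ be the Robinson--Schensted insertion tableau of $w$, obtained by row inserting $w_1,\dots,w_n$ in this order into the empty tableau. The shape of an array of rows is the list of its row lengths from top to bottom, and the array is called a standard tableau if its row lengths are weakly decreasing, its entries are $1,\dots,n$, each occurring once, and its rows (from left to right) and columns (from top to bottom) are increasing. The following are equivalent: 1. $\mathrm{SD}(w)=\mathrm{P}(w)$; 2. $\mathrm{SD}(w)$ is a standard tableau; 3. the shape of $\mathrm{SD}(w)$ equals the shape of $\mathrm{P}(w)$. -/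

import Mathlib

namespace BoxBall

/-- A state of the box-ball system with `n` balls: an injective map from the balls to the boxes,
the boxes being labelled by `ℕ` from left to right.  The balls are labelled by `Fin n`, with
`i : Fin n` standing for the ball `i + 1`. -/
abbrev State (n : ℕ) : Type := Fin n ↪ ℕ

/-- There is an empty box to the right of any given box. -/
theorem exists_empty_right {n : ℕ} (s : State n) (a : ℕ) : ∃ b, a < b ∧ ∀ j, s j ≠ b := by
  obtain ⟨b, hb⟩ := Infinite.exists_notMem_finset (Finset.univ.image s ∪ Finset.range (a + 1))
  simp only [Finset.mem_union, Finset.mem_image, Finset.mem_univ, true_and, Finset.mem_range,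
    not_or, not_exists] at hb
  exact ⟨b, by omega, hb.1⟩

/-- The nearest empty box to the right of ball `i`. -/
def nearestEmpty {n : ℕ} (s : State n) (i : Fin n) : ℕ :=
  Nat.find (exists_empty_right s (s i))

theorem nearestEmpty_spec {n : ℕ} (s : State n) (i : Fin n) :
    s i < nearestEmpty s i ∧ ∀ j, s j ≠ nearestEmpty s i :=
  Nat.find_spec (exists_empty_right s (s i))

/-- Ball `i` jumps to the nearest empty box to its right; the other balls stay. -/
def jump {n : ℕ} (s : State n) (i : Fin n) : State n where
  toFun := Function.update s i (nearestEmpty s i)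
  inj' := by
    have h := (nearestEmpty_spec s i).2
    intro a b hab
    by_cases ha : a = i <;> by_cases hb : b = i
    · rw [ha, hb]
    · subst ha
      rw [Function.update_self, Function.update_of_ne hb] at hab
      exact absurd hab.symm (h b)
    · subst hb
      rw [Function.update_self, Function.update_of_ne ha] at hab
      exact absurd hab (h a)
    · rw [Function.update_of_ne ha, Function.update_of_ne hb] at hab
      exact s.injective hab

/-- One move of the box-ball system: every ball jumps once, in the order `0, 1, …, n - 1`. -/
def move {n : ℕ} (s : State n) : State n :=
  (List.finRange n).foldl jump s

/-- The balls of a state, read from left to right. -/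
def word {n : ℕ} (s : State n) : List (Fin n) :=
  (List.finRange n).insertionSort (fun i j => s i ≤ s j)

/-- The maximal increasing strings of balls in consecutive boxes, from left to right: the word of
the state is cut between neighbours `i, j` unless `j` is in the box right after `i` and `i < j`. -/
def runs {n : ℕ} (s : State n) : List (List (Fin n)) :=
  (word s).splitBy (fun i j => decide (s j = s i + 1 ∧ i < j))

/-- A state is steady if its decomposition into maximal increasing strings of consecutive balls is
preserved by all subsequent moves (so that each of these strings is a soliton). -/
def IsSteady {n : ℕ} (s : State n) : Prop :=
  ∀ k : ℕ, runs (move^[k] s) = runs s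

/-- The state given by a permutation: the one-line notation `w 0, w 1, …, w (n - 1)` is placed in
the boxes `0, 1, …, n - 1`, so that ball `j` is in box `w⁻¹ j`. -/
def initialState {n : ℕ} (w : Equiv.Perm (Fin n)) : State n :=
  w.symm.toEmbedding.trans Fin.valEmbedding

/-- The state at time `t` of the box-ball system that starts with the permutation `w`. -/
def stateAt {n : ℕ} (w : Equiv.Perm (Fin n)) (t : ℕ) : State n :=
  move^[t] (initialState w)

/-- The rows, from the top, obtained by stacking the maximal increasing strings of a state, the
rightmost one being the first row. -/
def stack {n : ℕ} (s : State n) : List (List (Fin n)) :=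
  (runs s).reverse

open Classical in
/-- The soliton decomposition of `w`, as the list of its rows from top to bottom: the solitons of
a steady state of the system that starts with `w`, stacked from right to left. (The value is `[]`
if no steady state is reached.) -/
noncomputable def solitonDecomposition {n : ℕ} (w : Equiv.Perm (Fin n)) : List (List (Fin n)) :=
  if h : ∃ t, IsSteady (stateAt w t) then stack (stateAt w (Nat.find h)) else []

/-- The soliton decomposition does not depend on the steady state from which it is read. -/
theorem solitonDecomposition_eq {n : ℕ} (w : Equiv.Perm (Fin n)) (t : ℕ)
    (ht : IsSteady (stateAt w t)) : solitonDecomposition w = stack (stateAt w t) := by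
  classical
  have h : ∃ t, IsSteady (stateAt w t) := ⟨t, ht⟩
  have h1 := Nat.find_spec h
  have h2 : Nat.find h ≤ t := Nat.find_min' h ht
  have h3 : move^[t - Nat.find h] (stateAt w (Nat.find h)) = stateAt w t := by
    have h4 := Function.iterate_add_apply move (t - Nat.find h) (Nat.find h) (initialState w)
    rw [Nat.sub_add_cancel h2] at h4
    exact h4.symm
  have h5 := h1 (t - Nat.find h)
  rw [h3] at h5
  rw [solitonDecomposition, dif_pos h, stack, stack, h5]

/-- Insertion of `x` into an increasing row: `x` replaces the smallest entry larger than `x`, which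
is returned as the bumped entry, or is appended at the end if there is none. -/
def insertRow {n : ℕ} (x : Fin n) : List (Fin n) → List (Fin n) × Option (Fin n)
  | [] => ([x], none)
  | y :: ys =>
    if x < y then (x :: ys, some y)
    else (y :: (insertRow x ys).1, (insertRow x ys).2)

/-- Row insertion of `x` into a tableau, given as the list of its rows from top to bottom: `x` is
inserted into the first row, the bumped entry, if any, into the second row, and so on. -/
def insertTableau {n : ℕ} (x : Fin n) : List (List (Fin n)) → List (List (Fin n))
  | [] => [[x]]
  | r :: rs =>
    match insertRow x r with
    | (r', none) => r' :: rs
    | (r', some y) => r' :: insertTableau y rs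

/-- The Robinson--Schensted insertion tableau of `w`: the letters `w 0, w 1, …, w (n - 1)` are
inserted one after the other into the empty tableau. -/
def insertionTableau {n : ℕ} (w : Equiv.Perm (Fin n)) : List (List (Fin n)) :=
  (List.ofFn w).foldl (fun T x => insertTableau x T) []

/-- The shape of a tableau: the list of its row lengths, from top to bottom. -/
def shape {n : ℕ} (T : List (List (Fin n))) : List ℕ :=
  T.map List.length

/-- `T`, given as the list of its rows from top to bottom, is a standard tableau of size `n`: the
rows are nonempty and of weakly decreasing length, every entry of `Fin n` occurs exactly once, and
the rows (from left to right) and the columns (from top to bottom) are increasing. -/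
structure IsStandard {n : ℕ} (T : List (List (Fin n))) : Prop where
  row_ne_nil : ∀ r ∈ T, r ≠ []
  entries : T.flatten.Perm (List.finRange n)
  row_increasing : ∀ r ∈ T, r.Pairwise (· < ·)
  length_weakly_decreasing : (shape T).Pairwise (· ≥ ·)
  column_increasing : ∀ (k c : ℕ) (x y : Fin n),
    (T[k]?.bind fun r => r[c]?) = some x → (T[k + 1]?.bind fun r => r[c]?) = some y → x < y

end BoxBall

/-!
Two facts about a single move `s ↦ s' = move s` carry the proof.

*The runs.* Call the maximal increasing strings of consecutive balls the runs of a state. A run of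
`s'` starts exactly in the boxes right after the ends of the runs of `s`
(`isRunStart_move_succ`), so the number of runs is conserved and each run advances by its length.
A ball cannot stop inside its own run, because a ball only moves into a box that was empty or has
been left by a smaller ball; hence the index of the run that contains a given ball, counted from
the left, never decreases (`runIndex_le_runIndex_move`). These indices are bounded and determine
the runs (`runs_eq_of_runIndex_eq`), so the runs are eventually constant: a steady state is
reached.

*The plactic class.* A move can be carried out by a carrier that passes the boxes from left to
right, loads every ball it meets and exchanges it for the smallest larger ball it holds, and drops
its smallest ball at an empty box. An exchange is a row insertion into the carrier, hence a chain
of Knuth relations, and a drop does not change the word at all. So the words of `s` and `s'` have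
the same insertion tableau (`placticEquiv_word_move`), and `P(w)` is the insertion tableau of the
word of a steady state, which is the row reading word, from the bottom row to the top one, of
`SD(w)`.

It remains to compare an array `T` with increasing rows to the insertion tableau of its row reading
word. If `T` is a tableau, inserting its first row into the others bumps every row as a whole, and
the two agree (`IsSemistandard.insertWord_reading`). If only the shapes agree, the last inserted
row `R` ends up in a first row of its own length; as an increasing word is inserted into a row at
strictly increasing places, it must have bumped the whole first row of the tableau `Q` built so
far, so the result is `R` on top of `Q`, and induction applies
(`insertWord_reading_of_shape`).
-/

namespace BoxBall

variable {n : ℕ}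

/-! ### One move of the system, box by box -/

theorem foldl_jump_of_notMem (L : List (Fin n)) (s : State n) (i : Fin n) (hi : i ∉ L) :
    L.foldl jump s i = s i := by
  induction L generalizing s with
  | nil => rfl
  | cons a L ih =>
    rw [List.mem_cons, not_or] at hi
    rw [List.foldl_cons, ih _ hi.2]
    exact Function.update_of_ne hi.1 _ _

/-- When the turn of ball `i` comes, the balls `j < i` are already in their new boxes and the
balls `j ≥ i` are still in their old ones, and `i` jumps to the nearest empty box. -/
theorem move_apply (s : State n) (i : Fin n) :
    ∃ t : State n, (∀ j < i, t j = move s j) ∧ (∀ j ≥ i, t j = s j) ∧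
      move s i = nearestEmpty t i := by
  obtain ⟨L₁, L₂, hL⟩ := List.append_of_mem (List.mem_finRange i)
  have hp : (L₁ ++ i :: L₂).Pairwise (· < ·) := hL ▸ List.pairwise_lt_finRange n
  rw [List.pairwise_append, List.pairwise_cons] at hp
  obtain ⟨-, ⟨h2, -⟩, h1⟩ := hp
  have hmove : move s = L₂.foldl jump (jump (L₁.foldl jump s) i) := by
    rw [move, hL, List.foldl_append, List.foldl_cons]
  refine ⟨L₁.foldl jump s, fun j hj => ?_, fun j hj => ?_, ?_⟩
  · rw [hmove, foldl_jump_of_notMem _ _ _ fun h => (h2 j h).not_gt hj]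
    exact (Function.update_of_ne hj.ne _ _).symm
  · exact foldl_jump_of_notMem _ _ _ fun h => hj.not_gt (h1 j h i (by simp))
  · rw [hmove, foldl_jump_of_notMem _ _ _ fun h => (h2 i h).false]
    exact Function.update_self _ _ _

theorem lt_move (s : State n) (i : Fin n) : s i < move s i := by
  obtain ⟨t, -, h2, h3⟩ := move_apply s i
  rw [h3, ← h2 i le_rfl]
  exact (nearestEmpty_spec t i).1

/-- A ball can only move into a box that was empty or that a smaller ball has just left. -/
theorem lt_of_move_eq {s : State n} {j x : Fin n} (h : move s j = s x) : x < j := by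
  by_contra! hx
  obtain ⟨t, -, h2, h3⟩ := move_apply s j
  exact (nearestEmpty_spec t j).2 x (by rw [h2 x hx, ← h, h3])

/-- If ball `i` comes from the left of box `b` and does not stop before `b`, and the ball in `b`,
if any, is smaller than `i`, then after the move `b` contains a ball that is at most `i`. -/
theorem exists_move_eq {s : State n} {i : Fin n} {b : ℕ} (h1 : s i < b) (h2 : b ≤ move s i)
    (h3 : ∀ x, s x = b → x < i) : ∃ j ≤ i, move s j = b := by
  rcases h2.eq_or_lt with h2 | h2
  · exact ⟨i, le_rfl, h2.symm⟩
  obtain ⟨t, ht1, ht2, ht3⟩ := move_apply s i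
  have hmin := Nat.find_min (exists_empty_right t (t i)) (m := b) (by rw [ht3] at h2; exact h2)
  rw [ht2 i le_rfl] at hmin
  push Not at hmin
  obtain ⟨y, hy⟩ := hmin h1
  rcases lt_or_ge y i with hyi | hyi
  · exact ⟨y, hyi.le, by rw [← ht1 y hyi, hy]⟩
  · rw [ht2 y hyi] at hy
    exact absurd (h3 y hy) hyi.not_gt

/-! ### Runs and their indices -/

/-- A maximal increasing string of balls in consecutive boxes ends at box `b`. -/
def IsRunEnd (s : State n) (b : ℕ) : Prop :=
  ∃ x, s x = b ∧ ∀ y, s y = b + 1 → y < x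

/-- A maximal increasing string of balls in consecutive boxes starts at box `a`. -/
def IsRunStart (s : State n) (a : ℕ) : Prop :=
  ∃ x, s x = a ∧ ∀ y, s y + 1 = a → x < y

/-- The dynamics of the runs: a run of the next state starts right after the end of each run of
the present state, and nowhere else. -/
theorem isRunStart_move_succ (s : State n) (b : ℕ) :
    IsRunStart (move s) (b + 1) ↔ IsRunEnd s b := by
  constructor
  · rintro ⟨j, hj, hstart⟩
    have hlt := lt_move s j
    rcases (Nat.lt_succ_iff.1 (hj ▸ hlt)).eq_or_lt with hb | hb
    · exact ⟨j, hb, fun y hy => lt_of_move_eq (hj.trans hy.symm)⟩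
    -- Ball `j` flew over box `b`. If no run of `s` ended at `b`, a ball at most `j` would have
    -- settled there, against the choice of `j`.
    by_contra hend
    have hx : ∀ x, s x = b → x < j := by
      intro x hx
      by_contra! hjx
      have hne : j ≠ x := by rintro rfl; omega
      refine hend ⟨x, hx, fun y hy => ?_⟩
      exact (lt_of_move_eq (hj.trans hy.symm)).trans (lt_of_le_of_ne hjx hne)
    obtain ⟨y, hyj, hy⟩ := exists_move_eq hb (by omega) hx
    exact (hstart y (by omega)).not_ge hyj
  · rintro ⟨x, hx, hend⟩
    obtain ⟨j, hjx, hj⟩ := exists_move_eq (i := x) (b := b + 1) (by omega)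
      (hx ▸ lt_move s x) hend
    exact ⟨j, hj, fun y hy => hjx.trans_lt (lt_of_move_eq (by omega : move s y = s x))⟩

open Classical in
/-- The number of runs that end to the left of box `b`. -/
noncomputable def runEndsBefore (s : State n) (b : ℕ) : ℕ :=
  Nat.count (IsRunEnd s) b

open Classical in
theorem runEndsBefore_succ (s : State n) (b : ℕ) :
    runEndsBefore s (b + 1) = runEndsBefore s b + if IsRunEnd s b then 1 else 0 :=
  Nat.count_succ _ _

/-- The position, from the left and counted from `0`, of the run that contains ball `i`: the number
of runs that have ended before the box of `i`. -/
noncomputable def runIndex (s : State n) (i : Fin n) : ℕ :=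
  runEndsBefore s (s i)

theorem runEndsBefore_mono (s : State n) {a b : ℕ} (h : a ≤ b) :
    runEndsBefore s a ≤ runEndsBefore s b := by
  classical exact Nat.count_monotone _ h

/-- Runs do not overlap and fill the occupied boxes: up to and including an occupied box one more
run has started than has ended before it, and at an empty box every run that has started has
ended. -/
theorem count_isRunStart {s : State n} [DecidablePred (IsRunStart s)] (b : ℕ) :
    ((∃ x, s x = b) → Nat.count (IsRunStart s) (b + 1) = runEndsBefore s b + 1) ∧
    ((¬ ∃ x, s x = b) → Nat.count (IsRunStart s) (b + 1) = runEndsBefore s b) := by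
  classical
  induction b with
  | zero =>
    have h0 : runEndsBefore s 0 = 0 := Nat.count_zero _
    rw [h0, Nat.count_succ, Nat.count_zero]
    refine ⟨fun ⟨x, hx⟩ => ?_, fun h => ?_⟩
    · rw [if_pos ⟨x, hx, by omega⟩]
    · rw [if_neg fun ⟨x, hx, _⟩ => h ⟨x, hx⟩]
  | succ b ih =>
    rw [Nat.count_succ, runEndsBefore_succ]
    have hnot : (¬ ∃ x, s x = b) → ¬ IsRunEnd s b := fun h ⟨x, hx, _⟩ => h ⟨x, hx⟩
    refine ⟨fun ⟨y, hy⟩ => ?_, fun h => ?_⟩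
    · by_cases hb : ∃ x, s x = b
      · obtain ⟨x, hx⟩ := hb
        rw [ih.1 ⟨x, hx⟩]
        by_cases hyx : y < x
        · rw [if_pos, if_pos]
          · exact ⟨x, hx, fun z hz => s.injective (hz.trans hy.symm) ▸ hyx⟩
          · refine ⟨y, hy, fun z hz => ?_⟩
            rwa [s.injective (by omega : s z = s x)]
        · rw [if_neg, if_neg]
          · rintro ⟨x', hx', h⟩
            rw [s.injective (hx'.trans hx.symm)] at h
            exact hyx (h y hy)
          · rintro ⟨y', hy', h⟩
            rw [s.injective (hy'.trans hy.symm)] at h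
            exact hyx (h x (by omega))
      · rw [ih.2 hb, if_neg (hnot hb), if_pos]
        exact ⟨y, hy, fun z hz => absurd ⟨z, by omega⟩ hb⟩
    · rw [if_neg fun ⟨x, hx, _⟩ => h ⟨x, hx⟩]
      by_cases hb : ∃ x, s x = b
      · obtain ⟨x, hx⟩ := hb
        rw [ih.1 ⟨x, hx⟩, if_pos]
        exact ⟨x, hx, fun y hy => absurd ⟨y, hy⟩ h⟩
      · rw [ih.2 hb, if_neg (hnot hb)]

/-- After the move, ball `i` lies in the run that starts right after the last old run that ended
before its new box. -/
theorem runIndex_move_add_one (s : State n) (i : Fin n) :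
    runIndex (move s) i + 1 = runEndsBefore s (move s i) := by
  classical
  rw [runIndex, ← (count_isRunStart (s := move s) (move s i)).1 ⟨i, rfl⟩, Nat.count_succ',
    runEndsBefore]
  have h0 : ¬ IsRunStart (move s) 0 := by
    rintro ⟨x, hx, -⟩
    have := lt_move s x
    omega
  rw [if_neg h0, add_zero]
  congr 1
  funext b
  exact propext (isRunStart_move_succ s b)

/-- As long as no run ends, the boxes to the right of ball `i` contain larger and larger balls. -/
theorem exists_le_of_runEndsBefore_eq {s : State n} {i : Fin n} {d : ℕ}
    (h : runEndsBefore s (s i + d) = runIndex s i) : ∃ x ≥ i, s x = s i + d := by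
  classical
  induction d with
  | zero => exact ⟨i, le_rfl, rfl⟩
  | succ d ih =>
    rw [← add_assoc, runEndsBefore_succ] at h
    have hge := runEndsBefore_mono s (Nat.le_add_right (s i) d)
    obtain ⟨x, hix, hx⟩ := ih (by rw [runIndex] at h ⊢; omega)
    have hend : ¬ IsRunEnd s (s i + d) := by
      intro hend
      rw [if_pos hend, runIndex] at h
      omega
    rw [IsRunEnd] at hend
    push Not at hend
    obtain ⟨y, hy, hxy⟩ := hend x hx
    exact ⟨y, hix.trans hxy, hy⟩

/-- No ball ever falls back to an earlier run: a ball cannot stop inside its own run, because the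
boxes there have been left by larger balls. -/
theorem runIndex_le_runIndex_move (s : State n) (i : Fin n) :
    runIndex s i ≤ runIndex (move s) i := by
  by_contra! hlt
  have h1 := runIndex_move_add_one s i
  have h2 := lt_move s i
  have h3 := runEndsBefore_mono s h2.le
  have h4 : runIndex s i = runEndsBefore s (s i) := rfl
  obtain ⟨d, hd⟩ := Nat.exists_eq_add_of_lt h2
  rw [add_assoc] at hd
  obtain ⟨x, hix, hx⟩ := exists_le_of_runEndsBefore_eq (s := s) (i := i) (d := d + 1)
    (by rw [← hd]; omega)
  exact (lt_of_move_eq (hd.trans hx.symm)).not_ge hix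

theorem runIndex_le (s : State n) (i : Fin n) : runIndex s i ≤ n := by
  classical
  rw [runIndex, runEndsBefore, Nat.count_eq_card_filter_range]
  calc _ ≤ (Finset.univ.image s).card := by
        refine Finset.card_le_card fun b hb => ?_
        obtain ⟨x, hx, -⟩ := (Finset.mem_filter.1 hb).2
        exact Finset.mem_image.2 ⟨x, Finset.mem_univ _, hx⟩
    _ ≤ n := Finset.card_image_le.trans (by simp)

/-! ### The runs are determined by the run indices -/

/-- The word of a state lists the balls by run index, and by size within a run. -/
theorem lt_iff_runIndex {s : State n} {i j : Fin n} :
    s i < s j ↔ runIndex s i < runIndex s j ∨ runIndex s i = runIndex s j ∧ i < j := by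
  have key : ∀ {i j : Fin n}, s i < s j →
      runIndex s i < runIndex s j ∨ runIndex s i = runIndex s j ∧ i < j := by
    intro i j hij
    rcases (runEndsBefore_mono s hij.le).lt_or_eq with h | h
    · exact Or.inl h
    · obtain ⟨d, hd⟩ := Nat.exists_eq_add_of_le hij.le
      obtain ⟨x, hix, hx⟩ := exists_le_of_runEndsBefore_eq (s := s) (i := i) (d := d)
        (by rw [← hd]; exact h.symm)
      obtain rfl := s.injective (hx.trans hd.symm)
      exact Or.inr ⟨h, lt_of_le_of_ne hix (by rintro rfl; omega)⟩
  refine ⟨key, fun h => ?_⟩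
  by_contra! hle
  rcases hle.lt_or_eq with hlt | heq
  · have := key hlt
    omega
  · rw [s.injective heq] at h
    omega

theorem mem_word (s : State n) (i : Fin n) : i ∈ word s :=
  (List.perm_insertionSort _ _).mem_iff.2 (List.mem_finRange i)

theorem nodup_word (s : State n) : (word s).Nodup :=
  (List.perm_insertionSort _ _).nodup_iff.2 (List.nodup_finRange n)

theorem pairwise_word (s : State n) : (word s).Pairwise fun i j => s i < s j := by
  have : Std.Total fun i j : Fin n => s i ≤ s j := ⟨fun i j => le_total _ _⟩
  have : IsTrans (Fin n) fun i j => s i ≤ s j := ⟨fun i j k => le_trans⟩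
  have h := List.pairwise_insertionSort (fun i j => s i ≤ s j) (List.finRange n)
  exact (h.and (nodup_word s)).imp fun {i j} ⟨h1, h2⟩ => lt_of_le_of_ne h1 (s.injective.ne h2)

/-- A list that is sorted by position is determined by its members. -/
theorem eq_of_pairwise_of_mem_iff {s : State n} {l₁ l₂ : List (Fin n)}
    (h₁ : l₁.Pairwise fun i j => s i < s j) (h₂ : l₂.Pairwise fun i j => s i < s j)
    (h : ∀ i, i ∈ l₁ ↔ i ∈ l₂) : l₁ = l₂ := by
  have : Std.Irrefl fun i j : Fin n => s i < s j := ⟨fun i => lt_irrefl _⟩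
  have : Std.Antisymm fun i j : Fin n => s i < s j :=
    ⟨fun i j h h' => absurd h h'.not_gt⟩
  exact h₁.eq_of_mem_iff h₂ h

/-- Neighbours in the word of a state have no ball between them. -/
theorem isChain_word (s : State n) :
    (word s).IsChain fun i j => s i < s j ∧ ∀ y, s i < s y → s j ≤ s y := by
  rw [List.isChain_iff_getElem]
  have hp := List.pairwise_iff_getElem.1 (pairwise_word s)
  intro k hk
  refine ⟨hp _ _ _ _ (by omega), fun y hy => ?_⟩
  obtain ⟨m, hm, rfl⟩ := List.getElem_of_mem (mem_word s y)
  by_contra! hlt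
  rcases lt_trichotomy m k with h | rfl | h
  · exact (hp _ _ _ _ h).not_gt hy
  · exact hy.false
  · rcases (Nat.succ_le_of_lt h).eq_or_lt with h | h
    · subst h
      exact hlt.false
    · exact (hp _ _ _ _ h).not_gt hlt

theorem splitByLoop_congr {α : Type*} {r r' : α → α → Bool} (l : List α) (a : α)
    (g : List α) (gs : List (List α)) (h : (a :: l).IsChain fun x y => r x y = r' x y) :
    List.splitBy.loop r l a g gs = List.splitBy.loop r' l a g gs := by
  induction l generalizing a g gs with
  | nil => rfl
  | cons b l ih =>
    rw [List.isChain_cons_cons] at h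
    rw [List.splitBy.loop, List.splitBy.loop, h.1]
    split <;> exact ih _ _ _ h.2

theorem splitBy_congr {α : Type*} {r r' : α → α → Bool} {l : List α}
    (h : l.IsChain fun x y => r x y = r' x y) : l.splitBy r = l.splitBy r' := by
  cases l with
  | nil => rfl
  | cons a l => exact splitByLoop_congr _ _ _ _ h

theorem runs_eq_splitBy_runIndex (s : State n) :
    runs s = (word s).splitBy fun i j => decide (runIndex s i = runIndex s j) := by
  classical
  refine splitBy_congr ((isChain_word s).imp fun i j ⟨hij, hnext⟩ => ?_)
  rw [decide_eq_decide]
  constructor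
  · rintro ⟨h1, h2⟩
    rw [runIndex, runIndex, h1, runEndsBefore_succ, if_neg, add_zero]
    rintro ⟨x, hx, h⟩
    rw [s.injective hx] at h
    exact h2.not_gt (h j h1)
  · intro h
    have h1 : i < j := by
      rcases lt_iff_runIndex.1 hij with h' | h'
      · omega
      · exact h'.2
    have h2 := runEndsBefore_mono s (Nat.succ_le_of_lt hij)
    have h3 := runEndsBefore_mono s (Nat.le_succ (s i))
    obtain ⟨x, -, hx⟩ := exists_le_of_runEndsBefore_eq (s := s) (i := i) (d := 1)
      (by
        rw [runIndex, runIndex] at h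
        rw [runIndex]
        simp only [Nat.succ_eq_add_one] at h2 h3
        omega)
    exact ⟨by have := hnext x (by omega); omega, h1⟩

theorem runs_eq_of_runIndex_eq {s t : State n} (h : runIndex s = runIndex t) :
    runs s = runs t := by
  have hw : word s = word t := by
    refine eq_of_pairwise_of_mem_iff (s := s) (pairwise_word s) ?_ fun i => by simp [mem_word]
    refine (pairwise_word t).imp fun {i j} hij => ?_
    rwa [lt_iff_runIndex, h, ← lt_iff_runIndex]
  rw [runs_eq_splitBy_runIndex, runs_eq_splitBy_runIndex, h, hw]

/-! ### Convergence to a steady state -/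

/-- A steady state is reached, because the run indices of the balls never decrease and are
bounded. -/
theorem exists_isSteady (s : State n) : ∃ t, IsSteady (move^[t] s) := by
  have hmono : ∀ i, Monotone fun t => runIndex (move^[t] s) i := fun i =>
    monotone_nat_of_le_succ fun t => by
      rw [Function.iterate_succ_apply']
      exact runIndex_le_runIndex_move _ i
  have hbdd : ∀ i, ∃ t, ∀ u ≥ t, runIndex (move^[u] s) i = runIndex (move^[t] s) i := by
    intro i
    obtain ⟨t, ht⟩ := WellFoundedGT.monotone_chain_condition
      (⟨fun t => ⟨runIndex (move^[t] s) i, Nat.lt_succ_of_le (runIndex_le _ i)⟩,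
        fun a b h => hmono i h⟩ : ℕ →o Fin (n + 1))
    exact ⟨t, fun u hu => (Fin.ext_iff.1 (ht u hu)).symm⟩
  choose T hT using hbdd
  refine ⟨Finset.univ.sup T, fun k => runs_eq_of_runIndex_eq (funext fun i => ?_)⟩
  have hi : T i ≤ Finset.univ.sup T := Finset.le_sup (Finset.mem_univ i)
  rw [← Function.iterate_add_apply, hT i _ (by omega), hT i _ hi]

/-! ### Row insertion of words -/

/-- Row insertion of the letters of a word, one after the other, into a tableau. -/
def insertWord (T : List (List (Fin n))) (u : List (Fin n)) : List (List (Fin n)) :=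
  u.foldl (fun T x => insertTableau x T) T

@[simp] theorem insertWord_nil (T : List (List (Fin n))) : insertWord T [] = T := rfl

@[simp] theorem insertWord_cons (T : List (List (Fin n))) (x : Fin n) (u : List (Fin n)) :
    insertWord T (x :: u) = insertWord (insertTableau x T) u := rfl

theorem insertWord_append (T : List (List (Fin n))) (u v : List (Fin n)) :
    insertWord T (u ++ v) = insertWord (insertWord T u) v :=
  List.foldl_append ..

/-- Row insertion of the letters of a word, one after the other, into a single row: the final row
and the word of the bumped letters. -/
def insertWordRow : List (Fin n) → List (Fin n) → List (Fin n) × List (Fin n)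
  | [], R => (R, [])
  | x :: u, R =>
    ((insertWordRow u (insertRow x R).1).1,
      (insertRow x R).2.toList ++ (insertWordRow u (insertRow x R).1).2)

@[simp] theorem insertWordRow_nil (R : List (Fin n)) : insertWordRow [] R = (R, []) := rfl

theorem insertWordRow_cons (x : Fin n) (u R : List (Fin n)) :
    insertWordRow (x :: u) R = ((insertWordRow u (insertRow x R).1).1,
      (insertRow x R).2.toList ++ (insertWordRow u (insertRow x R).1).2) := rfl

theorem insertTableau_cons (x : Fin n) (R : List (Fin n)) (T : List (List (Fin n))) :
    insertTableau x (R :: T) = (insertRow x R).1 :: insertWord T (insertRow x R).2.toList := by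
  rw [insertTableau]
  split <;> rename_i h <;> simp [h]

/-- The word bumped from the first row is inserted into the remaining rows. -/
theorem insertWord_cons_tableau (u R : List (Fin n)) (T : List (List (Fin n))) :
    insertWord (R :: T) u = (insertWordRow u R).1 :: insertWord T (insertWordRow u R).2 := by
  induction u generalizing R T with
  | nil => rfl
  | cons x u ih => rw [insertWord_cons, insertTableau_cons, ih, insertWordRow_cons,
      insertWord_append]

theorem insertRow_nil (x : Fin n) : insertRow x [] = ([x], none) := rfl

theorem insertRow_of_lt {x a : Fin n} (h : x < a) (R : List (Fin n)) :
    insertRow x (a :: R) = (x :: R, some a) := by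
  rw [insertRow, if_pos h]

theorem insertRow_of_le {x a : Fin n} (h : a ≤ x) (R : List (Fin n)) :
    insertRow x (a :: R) = (a :: (insertRow x R).1, (insertRow x R).2) := by
  rw [insertRow, if_neg h.not_gt]

theorem insertWordRow_of_le {a : Fin n} {u : List (Fin n)} (h : ∀ x ∈ u, a ≤ x)
    (R : List (Fin n)) :
    insertWordRow u (a :: R) = (a :: (insertWordRow u R).1, (insertWordRow u R).2) := by
  induction u generalizing R with
  | nil => rfl
  | cons x u ih =>
    rw [List.forall_mem_cons] at h
    rw [insertWordRow_cons, insertRow_of_le h.1, ih h.2, insertWordRow_cons]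

theorem insertRow_perm (x : Fin n) (R : List (Fin n)) :
    ((insertRow x R).1 ++ (insertRow x R).2.toList).Perm (x :: R) := by
  induction R with
  | nil => rfl
  | cons a R ih =>
    rcases lt_or_ge x a with h | h
    · rw [insertRow_of_lt h]
      exact (List.perm_append_singleton a (x :: R)).trans (List.Perm.swap _ _ _)
    · rw [insertRow_of_le h]
      exact (ih.cons a).trans (List.Perm.swap _ _ _)

theorem mem_of_mem_insertRow {x y : Fin n} {R : List (Fin n)} (h : y ∈ (insertRow x R).1) :
    y = x ∨ y ∈ R :=
  List.mem_cons.1 ((insertRow_perm x R).subset (List.mem_append_left _ h))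

theorem mem_of_bumped {x y : Fin n} {R : List (Fin n)} (h : (insertRow x R).2 = some y) :
    x < y ∧ y ∈ R := by
  induction R with
  | nil => cases h
  | cons a R ih =>
    rcases lt_or_ge x a with hx | hx
    · rw [insertRow_of_lt hx] at h
      cases h
      exact ⟨hx, by simp⟩
    · rw [insertRow_of_le hx] at h
      exact ⟨(ih h).1, List.mem_cons_of_mem _ (ih h).2⟩

theorem pairwise_insertRow (x : Fin n) {R : List (Fin n)} (hR : R.Pairwise (· ≤ ·)) :
    (insertRow x R).1.Pairwise (· ≤ ·) := by
  induction R with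
  | nil => simp [insertRow_nil]
  | cons a R ih =>
    rw [List.pairwise_cons] at hR
    rcases lt_or_ge x a with hx | hx
    · rw [insertRow_of_lt hx]
      exact List.pairwise_cons.2 ⟨fun b hb => hx.le.trans (hR.1 b hb), hR.2⟩
    · rw [insertRow_of_le hx]
      refine List.pairwise_cons.2 ⟨fun b hb => ?_, ih hR.2⟩
      rcases mem_of_mem_insertRow hb with rfl | hb
      · exact hx
      · exact hR.1 b hb

theorem pairwise_insertTableau (x : Fin n) {T : List (List (Fin n))}
    (hT : ∀ R ∈ T, R.Pairwise (· ≤ ·)) : ∀ R ∈ insertTableau x T, R.Pairwise (· ≤ ·) := by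
  induction T generalizing x with
  | nil => simp [insertTableau]
  | cons R T ih =>
    rw [List.forall_mem_cons] at hT
    rw [insertTableau_cons, List.forall_mem_cons]
    refine ⟨pairwise_insertRow x hT.1, ?_⟩
    cases (insertRow x R).2 with
    | none => exact hT.2
    | some y => exact ih y hT.2

theorem pairwise_insertWord (u : List (Fin n)) {T : List (List (Fin n))}
    (hT : ∀ R ∈ T, R.Pairwise (· ≤ ·)) : ∀ R ∈ insertWord T u, R.Pairwise (· ≤ ·) := by
  induction u generalizing T with
  | nil => exact hT
  | cons x u ih => exact ih (pairwise_insertTableau x hT)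

/-! ### Invariance of row insertion under Knuth relations -/

/-- The two elementary Knuth relations between words of length three, each in one direction
only. -/
inductive KnuthStep : List (Fin n) → List (Fin n) → Prop
  | yxz {x y z : Fin n} (hxy : x < y) (hyz : y ≤ z) : KnuthStep [y, x, z] [y, z, x]
  | xzy {x y z : Fin n} (hxy : x ≤ y) (hyz : y < z) : KnuthStep [x, z, y] [z, x, y]

/-- If `y ≤ z` are inserted in this order, then `y` bumps at most as large a letter as `z`. -/
theorem bumped_le_bumped {y z z' : Fin n} (hyz : y ≤ z) {R : List (Fin n)}
    (hR : R.Pairwise (· ≤ ·)) (h : (insertRow z (insertRow y R).1).2 = some z') :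
    ∃ y', (insertRow y R).2 = some y' ∧ y' ≤ z' := by
  induction R with
  | nil =>
    rw [insertRow_nil, insertRow_of_le hyz] at h
    cases h
  | cons a R ih =>
    rw [List.pairwise_cons] at hR
    rcases lt_or_ge y a with ha | ha
    · rw [insertRow_of_lt ha, insertRow_of_le hyz] at h
      exact ⟨a, by rw [insertRow_of_lt ha], hR.1 _ (mem_of_bumped h).2⟩
    · rw [insertRow_of_le ha, insertRow_of_le (ha.trans hyz)] at h
      rw [insertRow_of_le ha]
      exact ih hR.2 h

/-- If `z` is inserted before a smaller letter `y`, then `y` bumps a letter that is at most `z`. -/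
theorem exists_bumped_le {y z : Fin n} (hyz : y < z) (R : List (Fin n)) :
    ∃ y', (insertRow y (insertRow z R).1).2 = some y' ∧ y' ≤ z := by
  induction R with
  | nil => exact ⟨z, by rw [insertRow_nil, insertRow_of_lt hyz], le_rfl⟩
  | cons a R ih =>
    rcases lt_or_ge z a with hz | hz
    · rw [insertRow_of_lt hz, insertRow_of_lt hyz]
      exact ⟨z, rfl, le_rfl⟩
    · rw [insertRow_of_le hz]
      rcases lt_or_ge y a with hy | hy
      · rw [insertRow_of_lt hy]
        exact ⟨a, rfl, hz⟩
      · rw [insertRow_of_le hy]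
        exact ih

/-- Inserting two Knuth-related words into a row gives the same row, and the bumped words are
again equal or Knuth-related. -/
theorem KnuthStep.insertWordRow {u v : List (Fin n)} (h : KnuthStep u v) {R : List (Fin n)}
    (hR : R.Pairwise (· ≤ ·)) :
    (insertWordRow u R).1 = (insertWordRow v R).1 ∧
      ((insertWordRow u R).2 = (insertWordRow v R).2 ∨
        KnuthStep (insertWordRow u R).2 (insertWordRow v R).2 ∨
        KnuthStep (insertWordRow v R).2 (insertWordRow u R).2) := by
  induction R with
  | nil =>
    rcases h with ⟨hxy, hyz⟩ | ⟨hxy, hyz⟩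
    · simp [insertWordRow_cons, insertRow_nil, insertRow_of_lt, insertRow_of_le, hxy, hyz,
        (hxy.le.trans hyz)]
    · simp [insertWordRow_cons, insertRow_nil, insertRow_of_lt, insertRow_of_le, hxy, hyz,
        (hxy.trans_lt hyz), (hxy.trans_lt hyz).le]
  | cons a R ih =>
    rw [List.pairwise_cons] at hR
    obtain ⟨haR, hR⟩ := hR
    by_cases hau : ∀ x ∈ u, a ≤ x
    · have hav : ∀ x ∈ v, a ≤ x := by
        rcases h with _ | _ <;> simp_all
      rw [insertWordRow_of_le hau, insertWordRow_of_le hav]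
      exact ⟨by rw [(ih hR).1], (ih hR).2⟩
    rcases h with @⟨x, y, z, hxy, hyz⟩ | @⟨x, y, z, hxy, hyz⟩
    · have hxa : x < a := by
        by_contra! hax
        exact hau (by simp [hax, hax.trans hxy.le, hax.trans (hxy.le.trans hyz)])
      have hxz := hxy.le.trans hyz
      rcases lt_or_ge y a with hya | hay
      · simp only [insertWordRow_cons, insertRow_of_lt hya, insertRow_of_lt hxy,
          insertRow_of_le hxz, insertRow_of_le hyz, insertWordRow_nil, Option.toList_some,
          List.append_nil, true_and]
        cases hz : (insertRow z R).2 with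
        | none => simp
        | some z' => exact Or.inr (Or.inl (.yxz hya (haR _ (mem_of_bumped hz).2)))
      · simp only [insertWordRow_cons, insertRow_of_le hay, insertRow_of_lt hxa,
          insertRow_of_le hxz, insertRow_of_le (hay.trans hyz), insertWordRow_nil,
          Option.toList_some, List.append_nil, true_and]
        cases hz : (insertRow z (insertRow y R).1).2 with
        | none => simp
        | some z' =>
          obtain ⟨y', hy', hyz'⟩ := bumped_le_bumped hyz hR hz
          rw [hy']
          exact Or.inr (Or.inl (.yxz (hay.trans_lt (mem_of_bumped hy').1) hyz'))
    · have hxa : x < a := by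
        by_contra! hax
        exact hau (by simp [hax, hax.trans hxy, (hax.trans hxy).trans hyz.le])
      have hxz := hxy.trans_lt hyz
      rcases lt_or_ge z a with hza | haz
      · simp only [insertWordRow_cons, insertRow_of_lt hza, insertRow_of_lt hxa,
          insertRow_of_lt hxz, insertRow_of_le hxz.le, insertRow_of_le hxy, insertWordRow_nil,
          Option.toList_some, List.append_nil]
        cases R with
        | nil => simp [insertRow_nil, insertRow_of_lt hyz]
        | cons h R =>
          have hah : a ≤ h := haR h (by simp)
          rw [insertRow_of_lt (hza.trans_le hah), insertRow_of_lt hyz,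
            insertRow_of_lt (hyz.trans (hza.trans_le hah))]
          exact ⟨rfl, Or.inr (Or.inr (.yxz hza hah))⟩
      · simp only [insertWordRow_cons, insertRow_of_le haz, insertRow_of_lt hxa,
          insertRow_of_le hxz.le, insertRow_of_le hxy, insertWordRow_nil,
          Option.toList_some, List.append_nil, true_and]
        obtain ⟨y', hy', hyz'⟩ := exists_bumped_le hyz R
        have hay' : a ≤ y' := by
          rcases mem_of_mem_insertRow (mem_of_bumped hy').2 with rfl | h
          · exact haz
          · exact haR _ h
        rw [hy']
        cases hz : (insertRow z R).2 with
        | none => simp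
        | some z' => exact Or.inr (Or.inl (.xzy hay' (hyz'.trans_lt (mem_of_bumped hz).1)))

theorem KnuthStep.insertWord_eq {u v : List (Fin n)} (h : KnuthStep u v)
    {T : List (List (Fin n))} (hT : ∀ R ∈ T, R.Pairwise (· ≤ ·)) :
    insertWord T u = insertWord T v := by
  induction T generalizing u v with
  | nil =>
    rcases h with ⟨hxy, hyz⟩ | ⟨hxy, hyz⟩
    · simp [insertTableau, insertRow_nil, insertRow_of_lt, insertRow_of_le, hxy, hyz,
        (hxy.le.trans hyz)]
    · simp [insertTableau, insertRow_nil, insertRow_of_lt, insertRow_of_le, hxy, hyz,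
        (hxy.trans_lt hyz), (hxy.trans_lt hyz).le]
  | cons R T ih =>
    rw [List.forall_mem_cons] at hT
    obtain ⟨h1, h2⟩ := h.insertWordRow hT.1
    rw [insertWord_cons_tableau, insertWord_cons_tableau, h1]
    rcases h2 with h2 | h2 | h2
    · rw [h2]
    · rw [ih h2 hT.2]
    · rw [ih h2 hT.2]

/-- Two words are plactically equivalent if row insertion of either of them into any list of
weakly increasing rows gives the same result. -/
def PlacticEquiv (u v : List (Fin n)) : Prop :=
  ∀ T : List (List (Fin n)), (∀ R ∈ T, R.Pairwise (· ≤ ·)) → insertWord T u = insertWord T v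

theorem PlacticEquiv.trans {u v w : List (Fin n)} (h : PlacticEquiv u v)
    (h' : PlacticEquiv v w) : PlacticEquiv u w :=
  fun T hT => (h T hT).trans (h' T hT)

theorem PlacticEquiv.append_right {u v : List (Fin n)} (h : PlacticEquiv u v)
    (w : List (Fin n)) : PlacticEquiv (u ++ w) (v ++ w) := fun T hT => by
  rw [insertWord_append, insertWord_append, h T hT]

theorem PlacticEquiv.append_left {u v : List (Fin n)} (w : List (Fin n))
    (h : PlacticEquiv u v) : PlacticEquiv (w ++ u) (w ++ v) := fun T hT => by
  rw [insertWord_append, insertWord_append, h _ (pairwise_insertWord w hT)]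

theorem KnuthStep.placticEquiv {u v : List (Fin n)} (h : KnuthStep u v) : PlacticEquiv u v :=
  fun _ hT => h.insertWord_eq hT

/-- A letter `x` moves to the left past larger letters, up to the smallest of them, `y`. -/
theorem placticEquiv_move_inserted {x y : Fin n} (hxy : x < y) (B : List (Fin n))
    (hB : (y :: B).Pairwise (· ≤ ·)) : PlacticEquiv (y :: B ++ [x]) (y :: x :: B) := by
  induction B generalizing y with
  | nil => exact fun _ _ => rfl
  | cons b B ih =>
    rw [List.pairwise_cons] at hB
    have hyb : y ≤ b := hB.1 b (by simp)
    have h1 := (ih (hxy.trans_le hyb) hB.2).append_left [y]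
    have h2 : PlacticEquiv ([y, b, x] ++ B) ([y, x, b] ++ B) :=
      PlacticEquiv.append_right (fun T hT => ((KnuthStep.yxz hxy hyb).placticEquiv T hT).symm) B
    exact h1.trans h2

/-- The letter `y` moves to the left past the letters that are at most `x`, where `x < y` is the
letter behind `y`. -/
theorem placticEquiv_move_bumped {x y : Fin n} (hxy : x < y) (A : List (Fin n))
    (hA : (A ++ [x]).Pairwise (· ≤ ·)) : PlacticEquiv (A ++ [y, x]) (y :: A ++ [x]) := by
  induction A using List.reverseRecOn generalizing x with
  | nil => exact fun _ _ => rfl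
  | append_singleton A a ih =>
    have hax : a ≤ x := (List.pairwise_append.1 hA).2.2 a (by simp) x (by simp)
    have h1 := (KnuthStep.xzy hax hxy).placticEquiv.append_left A
    have h2 := (ih (hax.trans_lt hxy) (List.pairwise_append.1 hA).1).append_right [x]
    simp only [List.append_assoc, List.cons_append, List.nil_append] at h1 h2 ⊢
    exact h1.trans h2

/-- Inserting `x` into the increasing row `A ++ y :: B`, where it bumps `y`, amounts to a chain of
Knuth relations. -/
theorem placticEquiv_bump {x y : Fin n} (hxy : x < y) {A B : List (Fin n)}
    (hA : (A ++ [x]).Pairwise (· ≤ ·)) (hB : (y :: B).Pairwise (· ≤ ·)) :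
    PlacticEquiv (A ++ y :: B ++ [x]) (y :: A ++ x :: B) := by
  have h1 := (placticEquiv_move_inserted hxy B hB).append_left A
  have h2 := (placticEquiv_move_bumped hxy A hA).append_right B
  simp only [List.append_assoc, List.cons_append, List.nil_append] at h1 h2 ⊢
  exact h1.trans h2

/-! ### The carrier -/

/-- The balls that are on their way across box `b` during a move, in increasing order: they come
from a box before `b` and stop in `b` or later. A carrier that runs through the boxes from left to
right holds these balls when it arrives at `b`. -/
def carrier (s : State n) (b : ℕ) : List (Fin n) :=
  (List.finRange n).filter fun i => s i < b ∧ b ≤ move s i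

/-- The balls in the boxes before `b`, read from left to right. -/
def wordBefore (s : State n) (b : ℕ) : List (Fin n) :=
  (word s).filter fun i => s i < b

/-- The balls in box `b` and the boxes after it, read from left to right. -/
def wordFrom (s : State n) (b : ℕ) : List (Fin n) :=
  (word s).filter fun i => b ≤ s i

theorem mem_carrier {s : State n} {b : ℕ} {i : Fin n} :
    i ∈ carrier s b ↔ s i < b ∧ b ≤ move s i := by
  simp [carrier]

theorem pairwise_carrier (s : State n) (b : ℕ) : (carrier s b).Pairwise (· < ·) :=
  (List.pairwise_lt_finRange n).filter _

theorem wordBefore_succ_of_eq {s : State n} {b : ℕ} {j : Fin n} (hj : s j = b) :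
    wordBefore s (b + 1) = wordBefore s b ++ [j] := by
  refine eq_of_pairwise_of_mem_iff ((pairwise_word s).filter _) ?_ fun i => ?_
  · refine List.pairwise_append.2 ⟨(pairwise_word s).filter _, by simp, fun i hi k hk => ?_⟩
    simp only [wordBefore, List.mem_filter, decide_eq_true_eq, List.mem_singleton] at hi hk
    rw [hk, hj]
    exact hi.2
  · have : s i = b ↔ i = j := by rw [← hj]; exact s.injective.eq_iff
    simp only [wordBefore, List.mem_append, List.mem_filter, mem_word, true_and,
      decide_eq_true_eq, List.mem_singleton, ← this]
    omega

theorem wordBefore_succ_of_ne {s : State n} {b : ℕ} (h : ∀ j, s j ≠ b) :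
    wordBefore s (b + 1) = wordBefore s b := by
  refine List.filter_congr fun i _ => ?_
  have := h i
  rw [decide_eq_decide]
  omega

theorem wordFrom_of_eq {s : State n} {b : ℕ} {x : Fin n} (hx : s x = b) :
    wordFrom s b = x :: wordFrom s (b + 1) := by
  refine eq_of_pairwise_of_mem_iff ((pairwise_word s).filter _) ?_ fun i => ?_
  · refine List.pairwise_cons.2 ⟨fun i hi => ?_, (pairwise_word s).filter _⟩
    simp only [wordFrom, List.mem_filter, decide_eq_true_eq] at hi
    omega
  · have : s i = b ↔ i = x := by rw [← hx]; exact s.injective.eq_iff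
    simp only [wordFrom, List.mem_cons, List.mem_filter, mem_word, true_and,
      decide_eq_true_eq, ← this]
    omega

theorem wordFrom_of_ne {s : State n} {b : ℕ} (h : ∀ x, s x ≠ b) :
    wordFrom s b = wordFrom s (b + 1) := by
  refine List.filter_congr fun i _ => ?_
  have := h i
  rw [decide_eq_decide]
  omega

theorem carrier_eq {s : State n} {b : ℕ} {l : List (Fin n)} (hl : l.Pairwise (· < ·))
    (h : ∀ i, s i < b ∧ b ≤ move s i ↔ i ∈ l) : carrier s b = l :=
  (pairwise_carrier s b).eq_of_mem_iff hl fun i => mem_carrier.trans (h i)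

/-- When the carrier passes box `b`, it exchanges the ball `x` there for the smallest larger ball
it holds, as in a row insertion; at an empty box it drops its smallest ball. In either case the
boxes behind the carrier, the carrier and the boxes ahead of it together keep the plactic class of
their word. -/
theorem placticEquiv_carrier_succ (s : State n) (b : ℕ) :
    PlacticEquiv (wordBefore (move s) b ++ carrier s b ++ wordFrom s b)
      (wordBefore (move s) (b + 1) ++ carrier s (b + 1) ++ wordFrom s (b + 1)) := by
  have hlt := lt_move s
  by_cases hx : ∃ x, s x = b
  · obtain ⟨x, hx⟩ := hx
    have hx' : ∀ i, s i = b ↔ i = x := fun i => by rw [← hx]; exact s.injective.eq_iff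
    rw [wordFrom_of_eq hx]
    by_cases hj : ∃ j, move s j = b
    -- The ball `x` bumps `j` from the carrier.
    · obtain ⟨j, hj⟩ := hj
      have hj' : ∀ i, move s i = b ↔ i = j := fun i => by
        rw [← hj]; exact (move s).injective.eq_iff
      have hxj : x < j := lt_of_move_eq (hj.trans hx.symm)
      have hmin : ∀ i, s i < b → b ≤ move s i → x < i → j ≤ i := by
        intro i h1 h2 h3
        obtain ⟨k, hk, hkb⟩ := exists_move_eq h1 h2 fun y hy => by rwa [(hx' y).1 hy]
        rwa [← (hj' k).1 hkb]
      have hxc : ¬ (s x < b) := by omega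
      have hjc : s j < b := hj ▸ hlt j
      have hA : ((carrier s b).filter (· < x) ++ [x]).Pairwise (· < ·) := by
        refine List.pairwise_append.2 ⟨(pairwise_carrier s b).filter _, by simp, fun i hi k hk => ?_⟩
        simp only [List.mem_filter, decide_eq_true_eq, List.mem_singleton] at hi hk
        exact hk ▸ hi.2
      have hB : (j :: (carrier s b).filter (j < ·)).Pairwise (· < ·) := by
        refine List.pairwise_cons.2 ⟨fun i hi => ?_, (pairwise_carrier s b).filter _⟩
        simp only [List.mem_filter, decide_eq_true_eq] at hi
        exact hi.2
      have hB' := List.pairwise_cons.1 hB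
      have h1 : carrier s b =
          (carrier s b).filter (· < x) ++ j :: (carrier s b).filter (j < ·) := by
        refine carrier_eq (List.pairwise_append.2 ⟨(List.pairwise_append.1 hA).1, hB,
          fun i hi k hk => ?_⟩) fun i => ?_
        · simp only [List.mem_filter, decide_eq_true_eq, List.mem_cons] at hi hk
          rcases hk with rfl | hk
          · exact hi.2.trans hxj
          · exact hi.2.trans (hxj.trans hk.2)
        · have := hmin i
          have := hx' i
          have := hj' i
          simp only [List.mem_filter, decide_eq_true_eq, List.mem_cons, List.mem_append,
            mem_carrier]
          grind
      have h2 : carrier s (b + 1) =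
          (carrier s b).filter (· < x) ++ x :: (carrier s b).filter (j < ·) := by
        refine carrier_eq (List.pairwise_append.2 ⟨(List.pairwise_append.1 hA).1,
          List.pairwise_cons.2 ⟨fun i hi => hxj.trans (hB'.1 i hi), hB'.2⟩,
          fun i hi k hk => ?_⟩) fun i => ?_
        · simp only [List.mem_filter, decide_eq_true_eq, List.mem_cons] at hi hk
          rcases hk with rfl | hk
          · exact hi.2
          · exact hi.2.trans (hxj.trans hk.2)
        · have := hmin i
          have := hx' i
          have := hj' i
          have := hlt i
          simp only [List.mem_filter, decide_eq_true_eq, List.mem_cons, List.mem_append,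
            mem_carrier]
          grind
      have h3 := ((placticEquiv_bump hxj (hA.imp le_of_lt) (hB.imp le_of_lt)).append_left
        (wordBefore (move s) b)).append_right (wordFrom s (b + 1))
      rw [wordBefore_succ_of_eq hj, h2, h1]
      simp only [← h1, List.append_assoc, List.cons_append, List.nil_append] at h3 ⊢
      exact h3
    -- The ball `x` is larger than all balls in the carrier.
    · push Not at hj
      have h1 : carrier s (b + 1) = carrier s b ++ [x] := by
        refine carrier_eq (List.pairwise_append.2 ⟨pairwise_carrier s b, by simp,
          fun i hi k hk => ?_⟩) fun i => ?_
        · rw [mem_carrier] at hi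
          rw [List.mem_singleton.1 hk]
          by_contra! hxi
          have hne : x ≠ i := by rintro rfl; omega
          obtain ⟨k, -, hk⟩ := exists_move_eq hi.1 hi.2 fun y hy => by
            rw [(hx' y).1 hy]; exact lt_of_le_of_ne hxi hne
          exact hj k hk
        · have := hx' i
          have := hj i
          have := hlt i
          rw [List.mem_append, mem_carrier, List.mem_singleton, ← hx']
          omega
      rw [wordBefore_succ_of_ne hj, h1]
      simp only [List.append_assoc, List.cons_append, List.nil_append]
      exact fun _ _ => rfl
  · push Not at hx
    rw [wordFrom_of_ne hx]
    by_cases hj : ∃ j, move s j = b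
    -- The carrier drops its smallest ball `j` into the empty box.
    · obtain ⟨j, hj⟩ := hj
      have hj' : ∀ i, move s i = b ↔ i = j := fun i => by
        rw [← hj]; exact (move s).injective.eq_iff
      have h1 : carrier s b = j :: carrier s (b + 1) := by
        refine carrier_eq (List.pairwise_cons.2 ⟨fun i hi => ?_, pairwise_carrier s _⟩)
          fun i => ?_
        · rw [mem_carrier] at hi
          have := hx i
          obtain ⟨k, hk, hkb⟩ := exists_move_eq (i := i) (b := b) (by omega) (by omega)
            fun y hy => absurd hy (hx y)
          rw [(hj' k).1 hkb] at hk
          exact lt_of_le_of_ne hk (by rintro rfl; omega)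
        · have := hx i
          have := hlt i
          rw [List.mem_cons, mem_carrier, ← hj']
          omega
      rw [wordBefore_succ_of_eq hj, h1]
      simp only [List.append_assoc, List.cons_append, List.nil_append]
      exact fun _ _ => rfl
    · push Not at hj
      have h1 : carrier s (b + 1) = carrier s b := by
        refine carrier_eq (pairwise_carrier s b) fun i => ?_
        have := hx i
        have := hj i
        rw [mem_carrier]
        omega
      rw [wordBefore_succ_of_ne hj, h1]
      exact fun _ _ => rfl

/-- A move does not change the plactic class of the word of a state. -/
theorem placticEquiv_word_move (s : State n) : PlacticEquiv (word s) (word (move s)) := by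
  have key : ∀ b, PlacticEquiv (word s)
      (wordBefore (move s) b ++ carrier s b ++ wordFrom s b) := by
    intro b
    induction b with
    | zero =>
      have h1 : wordBefore (move s) 0 = [] := by simp [wordBefore]
      have h2 : carrier s 0 = [] := by simp [carrier]
      have h3 : wordFrom s 0 = word s := by simp [wordFrom]
      rw [h1, h2, h3]
      exact fun _ _ => rfl
    | succ b ih => exact ih.trans (placticEquiv_carrier_succ s b)
  obtain ⟨N, hN⟩ : ∃ N, ∀ i, move s i < N :=
    ⟨Finset.univ.sup (move s) + 1, fun i => Nat.lt_succ_of_le (Finset.le_sup (Finset.mem_univ i))⟩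
  have h1 : wordBefore (move s) N = word (move s) := by
    simp [wordBefore, hN]
  have h2 : carrier s N = [] := by
    simp [carrier, hN]
  have h3 : wordFrom s N = [] := by
    simp [wordFrom, fun i => (lt_move s i).trans (hN i)]
  simpa [h1, h2, h3] using key N

theorem placticEquiv_word_iterate_move (s : State n) (t : ℕ) :
    PlacticEquiv (word s) (word (move^[t] s)) := by
  induction t with
  | zero => exact fun _ _ => rfl
  | succ t ih =>
    rw [Function.iterate_succ_apply']
    exact ih.trans (placticEquiv_word_move _)

theorem word_initialState (w : Equiv.Perm (Fin n)) : word (initialState w) = List.ofFn w := by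
  refine eq_of_pairwise_of_mem_iff (pairwise_word _) ?_ fun i => ?_
  · rw [List.pairwise_ofFn]
    intro i j hij
    simpa [initialState] using hij
  · simpa [mem_word, List.mem_ofFn] using w.surjective i

/-- The insertion tableau can be read off from the word of any later state. -/
theorem insertWord_word_stateAt (w : Equiv.Perm (Fin n)) (t : ℕ) :
    insertWord [] (word (stateAt w t)) = insertionTableau w := by
  rw [insertionTableau, ← word_initialState]
  exact (placticEquiv_word_iterate_move (initialState w) t [] (by simp)).symm

/-! ### Tableaux -/

/-- The row `R` can stand on top of the row `R'` in a tableau: it is at least as long, and its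
entries are smaller than the entries of `R'` below them. -/
def Dominates : List (Fin n) → List (Fin n) → Prop
  | _, [] => True
  | [], _ :: _ => False
  | a :: R, b :: R' => a < b ∧ Dominates R R'

/-- Semistandard tableaux, given as the list of their rows from top to bottom: the rows are
nonempty and weakly increasing, and the columns are strictly increasing. -/
def IsSemistandard : List (List (Fin n)) → Prop
  | [] => True
  | R :: T => R ≠ [] ∧ R.Pairwise (· ≤ ·) ∧ (∀ R' ∈ T.head?, Dominates R R') ∧ IsSemistandard T

theorem dominates_nil (R : List (Fin n)) : Dominates R [] := by
  cases R <;> trivial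

theorem dominates_iff {R R' : List (Fin n)} : Dominates R R' ↔
    R'.length ≤ R.length ∧ ∀ (c : ℕ) (x y : Fin n), R[c]? = some x → R'[c]? = some y → x < y := by
  induction R' generalizing R with
  | nil => simp [dominates_nil]
  | cons b R' ih =>
    cases R with
    | nil => simp [Dominates]
    | cons a R =>
      simp only [Dominates, ih, List.length_cons, add_le_add_iff_right]
      constructor
      · rintro ⟨hab, hl, h⟩
        refine ⟨hl, fun c x y hx hy => ?_⟩
        cases c with
        | zero => simp_all
        | succ c => exact h c x y (by simpa using hx) (by simpa using hy)
      · rintro ⟨hl, h⟩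
        exact ⟨h 0 a b rfl rfl, hl, fun c x y hx hy => h (c + 1) x y (by simpa using hx)
          (by simpa using hy)⟩

/-- Row insertion only decreases the entries of a row, so it preserves domination. -/
theorem Dominates.insertRow_left {R R' : List (Fin n)} (h : Dominates R R') (x : Fin n) :
    Dominates (insertRow x R).1 R' := by
  induction R' generalizing R with
  | nil => exact dominates_nil _
  | cons b R' ih =>
    cases R with
    | nil => exact h.elim
    | cons a R =>
      rcases lt_or_ge x a with hx | hx
      · rw [insertRow_of_lt hx]
        exact ⟨hx.trans h.1, h.2⟩
      · rw [insertRow_of_le hx]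
        exact ⟨h.1, ih h.2⟩

theorem Dominates.insertRow_bumped {R R' : List (Fin n)} (h : Dominates R R')
    (hR : R.Pairwise (· ≤ ·)) {x y : Fin n} (hy : (insertRow x R).2 = some y) :
    Dominates (insertRow x R).1 (insertRow y R').1 := by
  induction R generalizing R' with
  | nil => cases hy
  | cons a R ih =>
    have hRc := List.pairwise_cons.1 hR
    rcases lt_or_ge x a with hx | hx
    · rw [insertRow_of_lt hx] at hy ⊢
      cases hy
      cases R' with
      | nil => exact ⟨hx, dominates_nil _⟩
      | cons b R' =>
        rw [insertRow_of_lt h.1]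
        exact ⟨hx, h.2⟩
    · rw [insertRow_of_le hx] at hy ⊢
      have hay : a < y := hx.trans_lt (mem_of_bumped hy).1
      cases R' with
      | nil => exact ⟨hay, dominates_nil _⟩
      | cons b R' =>
        rcases lt_or_ge y b with hyb | hyb
        · rw [insertRow_of_lt hyb]
          exact ⟨hay, h.2.insertRow_left x⟩
        · rw [insertRow_of_le hyb]
          exact ⟨h.1, ih h.2 hRc.2 hy⟩

theorem IsSemistandard.insertTableau {T : List (List (Fin n))} (hT : IsSemistandard T)
    (x : Fin n) : IsSemistandard (insertTableau x T) := by
  induction T generalizing x with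
  | nil => simp [BoxBall.insertTableau, IsSemistandard]
  | cons R T ih =>
    obtain ⟨hne, hR, hdom, hT⟩ := hT
    have hne' : (insertRow x R).1 ≠ [] := by
      cases R with
      | nil => exact absurd rfl hne
      | cons a R => rw [insertRow]; split <;> simp
    rw [insertTableau_cons]
    refine ⟨hne', pairwise_insertRow x hR, ?_⟩
    cases hy : (insertRow x R).2 with
    | none => exact ⟨fun R' hR' => (hdom R' hR').insertRow_left x, hT⟩
    | some y =>
      refine ⟨fun R' hR' => ?_, ih hT y⟩
      cases T with
      | nil =>
        obtain rfl : [y] = R' := by simpa [BoxBall.insertTableau] using hR'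
        exact (dominates_nil R).insertRow_bumped hR hy
      | cons R'' T =>
        obtain rfl : (insertRow y R'').1 = R' := by simpa [insertTableau_cons] using hR'
        exact (hdom R'' rfl).insertRow_bumped hR hy

theorem IsSemistandard.insertWord {T : List (List (Fin n))} (hT : IsSemistandard T)
    (u : List (Fin n)) : IsSemistandard (insertWord T u) := by
  induction u generalizing T with
  | nil => exact hT
  | cons x u ih => exact ih (hT.insertTableau x)

theorem insertTableau_perm (x : Fin n) (T : List (List (Fin n))) :
    (insertTableau x T).flatten.Perm (x :: T.flatten) := by
  induction T generalizing x with
  | nil => simp [insertTableau]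
  | cons R T ih =>
    rw [insertTableau_cons, List.flatten_cons, List.flatten_cons, ← List.cons_append]
    refine List.Perm.trans ?_ ((insertRow_perm x R).append_right T.flatten)
    rw [List.append_assoc]
    refine List.Perm.append_left _ ?_
    cases (insertRow x R).2 with
    | none => rfl
    | some y => exact ih y

theorem insertWord_perm (u : List (Fin n)) (T : List (List (Fin n))) :
    (insertWord T u).flatten.Perm (u ++ T.flatten) := by
  induction u generalizing T with
  | nil => rfl
  | cons x u ih =>
    exact (ih _).trans (((insertTableau_perm x T).append_left u).trans List.perm_middle)

theorem IsSemistandard.row {T : List (List (Fin n))} (hT : IsSemistandard T) :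
    ∀ R ∈ T, R ≠ [] ∧ R.Pairwise (· ≤ ·) := by
  induction T with
  | nil => simp
  | cons R T ih => exact List.forall_mem_cons.2 ⟨⟨hT.1, hT.2.1⟩, ih hT.2.2.2⟩

theorem IsSemistandard.length_head {R : List (Fin n)} {T : List (List (Fin n))}
    (hT : IsSemistandard (R :: T)) : ∀ R' ∈ T, R'.length ≤ R.length := by
  induction T generalizing R with
  | nil => simp
  | cons R₁ T ih =>
    have h1 := (dominates_iff.1 (hT.2.2.1 R₁ rfl)).1
    exact List.forall_mem_cons.2 ⟨h1, fun R' hR' => (ih hT.2.2.2 R' hR').trans h1⟩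

theorem IsSemistandard.isStandard {T : List (List (Fin n))} (hT : IsSemistandard T)
    (hp : T.flatten.Perm (List.finRange n)) : IsStandard T where
  row_ne_nil R hR := (hT.row R hR).1
  entries := hp
  row_increasing R hR := by
    have hnd : R.Nodup :=
      (List.nodup_flatten.1 (hp.nodup_iff.2 (List.nodup_finRange n))).1 R hR
    exact ((hT.row R hR).2.and hnd).imp fun {a b} h => lt_of_le_of_ne h.1 h.2
  length_weakly_decreasing := by
    rw [shape, List.pairwise_map]
    clear hp
    induction T with
    | nil => simp
    | cons R T ih => exact List.pairwise_cons.2 ⟨hT.length_head, ih hT.2.2.2⟩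
  column_increasing := by
    clear hp
    intro k c x y hx hy
    induction T generalizing k with
    | nil => simp at hx
    | cons R T ih =>
      cases k with
      | zero =>
        cases T with
        | nil => simp at hy
        | cons R' T =>
          exact (dominates_iff.1 (hT.2.2.1 R' rfl)).2 c x y (by simpa using hx) (by simpa using hy)
      | succ k => exact ih hT.2.2.2 k (by simpa using hx) (by simpa using hy)

theorem IsStandard.isSemistandard {T : List (List (Fin n))} (hT : IsStandard T) :
    IsSemistandard T := by
  obtain ⟨h1, -, h3, h4, h5⟩ := hT
  rw [shape, List.pairwise_map] at h4
  induction T with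
  | nil => trivial
  | cons R T ih =>
    refine ⟨h1 R (by simp), (h3 R (by simp)).imp le_of_lt, fun R' hR' => ?_, ih ?_ ?_ ?_ ?_⟩
    · cases T with
      | nil => simp at hR'
      | cons R₁ T =>
        obtain rfl : R₁ = R' := by simpa using hR'
        exact dominates_iff.2 ⟨(List.pairwise_cons.1 h4).1 R₁ (by simp),
          fun c x y hx hy => h5 0 c x y (by simpa using hx) (by simpa using hy)⟩
    · exact fun R' hR' => h1 R' (List.mem_cons_of_mem _ hR')
    · exact fun R' hR' => h3 R' (List.mem_cons_of_mem _ hR')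
    · exact (List.pairwise_cons.1 h4).2
    · exact fun k c x y hx hy => h5 (k + 1) c x y (by simpa using hx) (by simpa using hy)

theorem insertionTableau_isStandard (w : Equiv.Perm (Fin n)) :
    IsStandard (insertionTableau w) := by
  refine IsSemistandard.isStandard (IsSemistandard.insertWord (T := []) trivial (List.ofFn w)) ?_
  refine (insertWord_perm (List.ofFn w) []).trans ?_
  rw [List.flatten_nil, List.append_nil, ← word_initialState]
  exact List.perm_insertionSort _ _

/-! ### Inserting an increasing word -/

theorem insertWordRow_nil_right {u : List (Fin n)} (hu : u.Pairwise (· ≤ ·)) :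
    insertWordRow u [] = (u, []) := by
  induction u with
  | nil => rfl
  | cons x u ih =>
    rw [List.pairwise_cons] at hu
    rw [insertWordRow_cons, insertRow_nil, insertWordRow_of_le hu.1, ih hu.2]
    rfl

theorem insertWordRow_of_dominates {u R : List (Fin n)} (hu : u.Pairwise (· ≤ ·))
    (h : Dominates u R) : insertWordRow u R = (u, R) := by
  induction u generalizing R with
  | nil =>
    cases R with
    | nil => rfl
    | cons a R => exact h.elim
  | cons x u ih =>
    cases R with
    | nil => exact insertWordRow_nil_right hu
    | cons a R =>
      have hu' := List.pairwise_cons.1 hu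
      rw [insertWordRow_cons, insertRow_of_lt h.1, insertWordRow_of_le hu'.1, ih hu'.2 h.2]
      rfl

/-- The letters of an increasing word land at strictly increasing places of a row, so the final row
is at least as long as the word. If it is not longer, the letters have taken the places from the
left one by one and the whole old row has been bumped. -/
theorem length_le_insertWordRow {u : List (Fin n)} (hu : u.Pairwise (· ≤ ·)) (R : List (Fin n)) :
    u.length ≤ (insertWordRow u R).1.length ∧
      ((insertWordRow u R).1.length = u.length → insertWordRow u R = (u, R)) := by
  induction R generalizing u with
  | nil => simp [insertWordRow_nil_right hu]
  | cons a R ih =>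
    cases u with
    | nil => simp
    | cons x u =>
      have hu' := List.pairwise_cons.1 hu
      rcases lt_or_ge x a with hx | hx
      · obtain ⟨h1, h2⟩ := ih hu'.2
        rw [insertWordRow_cons, insertRow_of_lt hx, insertWordRow_of_le hu'.1]
        refine ⟨by simpa using h1, fun h => ?_⟩
        rw [h2 (by simpa using h)]
        rfl
      · obtain ⟨h1, -⟩ := ih hu
        rw [insertWordRow_of_le (List.forall_mem_cons.2 ⟨hx, fun y hy => hx.trans (hu'.1 y hy)⟩)]
        simp only [List.length_cons] at h1 ⊢
        exact ⟨by omega, fun h => by omega⟩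

theorem insertWord_nil_left {u : List (Fin n)} (hu : u.Pairwise (· ≤ ·)) (hne : u ≠ []) :
    insertWord [] u = [u] := by
  cases u with
  | nil => exact absurd rfl hne
  | cons x u =>
    have hu' := List.pairwise_cons.1 hu
    rw [insertWord_cons, insertTableau, insertWord_cons_tableau, insertWordRow_of_le hu'.1,
      insertWordRow_nil_right hu'.2]
    rfl

/-- Inserting the first row of a tableau into the remaining rows gives back the tableau: each row
is bumped as a whole by the row above it. -/
theorem IsSemistandard.insertWord_head {R : List (Fin n)} {T : List (List (Fin n))}
    (hT : IsSemistandard (R :: T)) : BoxBall.insertWord T R = R :: T := by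
  induction T generalizing R with
  | nil => exact insertWord_nil_left hT.2.1 hT.1
  | cons R' T ih =>
    rw [insertWord_cons_tableau, insertWordRow_of_dominates hT.2.1 (hT.2.2.1 R' rfl),
      ih hT.2.2.2]

/-- A tableau is the insertion tableau of its row reading word. -/
theorem IsSemistandard.insertWord_reading {T : List (List (Fin n))} (hT : IsSemistandard T) :
    BoxBall.insertWord [] T.reverse.flatten = T := by
  induction T with
  | nil => rfl
  | cons R T ih =>
    rw [List.reverse_cons, List.flatten_append, insertWord_append, ih hT.2.2.2,
      List.flatten_singleton, hT.insertWord_head]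

/-- An array with increasing rows whose reading word has an insertion tableau of the same shape is
this insertion tableau: the length of the first row forces the last inserted row to bump the whole
first row of the tableau built before it. -/
theorem insertWord_reading_of_shape {T : List (List (Fin n))}
    (hT : ∀ R ∈ T, R ≠ [] ∧ R.Pairwise (· ≤ ·))
    (h : shape (insertWord [] T.reverse.flatten) = shape T) :
    insertWord [] T.reverse.flatten = T := by
  induction T with
  | nil => rfl
  | cons R T ih =>
    obtain ⟨⟨hne, hR⟩, hT⟩ := List.forall_mem_cons.1 hT
    rw [List.reverse_cons, List.flatten_append, insertWord_append, List.flatten_singleton] at h ⊢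
    have hQ : IsSemistandard (insertWord [] T.reverse.flatten) :=
      IsSemistandard.insertWord (T := []) trivial _
    generalize hQe : insertWord [] T.reverse.flatten = Q at *
    cases Q with
    | nil =>
      rw [insertWord_nil_left hR hne] at h ⊢
      simpa [shape, eq_comm] using h
    | cons R' Q =>
      rw [insertWord_cons_tableau] at h ⊢
      have hrow := (length_le_insertWordRow hR R').2 (List.cons_eq_cons.1 h).1
      rw [hrow, hQ.insertWord_head] at h ⊢
      rw [ih hT (List.cons_eq_cons.1 h).2]

/-! ### The rows of a state -/

theorem runs_row {s : State n} {R : List (Fin n)} (hR : R ∈ runs s) :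
    R ≠ [] ∧ R.Pairwise (· ≤ ·) := by
  refine ⟨List.ne_nil_of_mem_splitBy hR, ?_⟩
  rw [← List.isChain_iff_pairwise]
  exact (List.isChain_of_mem_splitBy hR).imp fun i j h => (of_decide_eq_true h).2.le

theorem flatten_reverse_stack (s : State n) : (stack s).reverse.flatten = word s := by
  rw [stack, List.reverse_reverse]
  exact List.flatten_splitBy _ _

end BoxBall

theorem theorem4p2 {n : ℕ} (w : Equiv.Perm (Fin n)) :
    (∃ t : ℕ, BoxBall.IsSteady (BoxBall.stateAt w t)) ∧
    List.TFAE
      [BoxBall.solitonDecomposition w = BoxBall.insertionTableau w,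
       BoxBall.IsStandard (BoxBall.solitonDecomposition w),
       BoxBall.shape (BoxBall.solitonDecomposition w) =
         BoxBall.shape (BoxBall.insertionTableau w)] := by
  obtain ⟨t, ht⟩ : ∃ t : ℕ, BoxBall.IsSteady (BoxBall.stateAt w t) :=
    BoxBall.exists_isSteady (BoxBall.initialState w)
  refine ⟨⟨t, ht⟩, ?_⟩
  have hP : BoxBall.insertWord [] (BoxBall.solitonDecomposition w).reverse.flatten =
      BoxBall.insertionTableau w := by
    rw [BoxBall.solitonDecomposition_eq w t ht, BoxBall.flatten_reverse_stack,
      BoxBall.insertWord_word_stateAt]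
  have hrow : ∀ R ∈ BoxBall.solitonDecomposition w, R ≠ [] ∧ R.Pairwise (· ≤ ·) := by
    rw [BoxBall.solitonDecomposition_eq w t ht]
    exact fun R hR => BoxBall.runs_row (List.mem_reverse.1 hR)
  tfae_have 1 → 2 := fun h => h ▸ BoxBall.insertionTableau_isStandard w
  tfae_have 2 → 1 := fun h => by rw [← hP, h.isSemistandard.insertWord_reading]
  tfae_have 1 → 3 := fun h => by rw [h]
  tfae_have 3 → 1 := fun h => by
    rw [← hP] at h ⊢
    exact (BoxBall.insertWord_reading_of_shape hrow h.symm).symm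
  tfae_finish
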